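/- Let $\omega^{*}=\beta(\omega)\setminus\omega$ be the Stone–Čech remainder of the countably infinite discrete space $\omega$. For topological spaces $X$ and $Y$, write $X\rightarrow(Y)^{1}_{2}$ if, whenever $X=P_{0}\cup P_{1}$, at least one of $P_{0},P_{1}$ contains a subspace homeomorphic to $Y$. **Theorem 5.14.** For every infinite countably compact space $Y$, the relation $\omega^{*}\rightarrow(Y)^{1}_{2}$ fails; that is, $\omega^{*}$ can be written as $P_{0}\cup P_{1}$ in such a way that neither $P_{0}$ nor $P_{1}$ contains a homeomorphic copy of $Y$. -/

import Mathlib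

/-- The space `ω* = β(ω) \ ω`, the Stone–Čech remainder of the countably infinite discrete
space, with the subspace topology inherited from `β(ω)`. -/
abbrev OmegaStar : Type :=
  {x : StoneCech ℕ // x ∉ Set.range (stoneCechUnit : ℕ → StoneCech ℕ)}

/-- Topological inclusion: the subset `P` of `X` contains a homeomorphic copy of `Y`. -/
def TopIncluded (Y : Type*) [TopologicalSpace Y] {X : Type*} [TopologicalSpace X]
    (P : Set X) : Prop :=
  ∃ Y' : Set X, Y' ⊆ P ∧ Nonempty (Y ≃ₜ Y')

/-- The topological partition relation `X → (Y)¹₂`: whenever `X = P₀ ∪ P₁`, at least one of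
`P₀`, `P₁` contains a homeomorphic copy of `Y`. -/
def TopArrow (X Y : Type*) [TopologicalSpace X] [TopologicalSpace Y] : Prop :=
  ∀ P₀ P₁ : Set X, P₀ ∪ P₁ = Set.univ → TopIncluded Y P₀ ∨ TopIncluded Y P₁

open Filter Topology Set

namespace OmegaStarPartition

/-! The colouring depends only on a nonprincipal ultrafilter `p` obtained from `Y`. Being countably
compact and, as a subspace of `ω*`, Hausdorff, `Y` has a sequence `d` in disjoint open sets
converging along `p` to some `y₀`. Every embedding turns `d` into a separated sequence of
ultrafilters. Separated sequences with the same `p`-limit agree `p`-almost everywhere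
(`IsSeparatedBy.eventuallyEq`), so it suffices to choose one for each limit and colour the limit
unlike almost all its terms (`exists_coloring`). Then no copy of `Y` is monochromatic. -/

/-- No ultrafilter on `ℕ` is fixed by a map that is regressive on one of its members. -/
theorem not_eventually_lt_of_tendsto {p : Ultrafilter ℕ} {h : ℕ → ℕ}
    (hp : Tendsto h p p) : ¬ ∀ᶠ n in (p : Filter ℕ), h n < n := by
  intro hlt
  -- colour `n` so that `n` and `h n` have different colours whenever `h n < n`
  obtain ⟨c, hc⟩ : ∃ c : ℕ → Prop, ∀ n, h n < n → (c n ↔ ¬ c (h n)) := by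
    let F : (n : ℕ) → ((m : ℕ) → m < n → Prop) → Prop :=
      fun n ih => ∃ hn : h n < n, ¬ ih (h n) hn
    refine ⟨fun n => WellFounded.fix Nat.lt_wfRel.wf F n, fun n hn => ?_⟩
    beta_reduce
    rw [WellFounded.fix_eq]
    exact ⟨fun ⟨_, h2⟩ => h2, fun h2 => ⟨hn, h2⟩⟩
  rcases Ultrafilter.eventually_or.1
    (Eventually.of_forall (f := (p : Filter ℕ)) fun n => em (c n)) with h1 | h1
  · obtain ⟨n, h2, h3, h4⟩ := ((hp.eventually h1).and (h1.and hlt)).exists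
    exact (hc n h4).1 h3 h2
  · obtain ⟨n, h2, h3, h4⟩ := ((hp.eventually h1).and (h1.and hlt)).exists
    exact h3 ((hc n h4).2 h2)

/-! ### Separated sequences and their limits -/

/-- A sequence of ultrafilters containing pairwise disjoint sets, given as the fibres of `r`. -/
def IsSeparatedBy (f : ℕ → Ultrafilter ℕ) (r : ℕ → ℕ) : Prop :=
  ∀ n, ∀ᶠ k in (f n : Filter ℕ), r k = n

theorem tendsto_nhds_iff {p : Filter ℕ} {f : ℕ → Ultrafilter ℕ} {x : Ultrafilter ℕ} :
    Tendsto f p (𝓝 x) ↔ ∀ s ∈ x, ∀ᶠ n in p, s ∈ f n := by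
  rw [ultrafilterBasis_is_basis.nhds_hasBasis.tendsto_right_iff]
  constructor
  · intro h s hs
    exact h {u | s ∈ u} ⟨⟨s, rfl⟩, hs⟩
  · rintro h _ ⟨⟨s, rfl⟩, hs⟩
    exact h s hs

theorem mem_of_eventually_mem {p : Ultrafilter ℕ} {f : ℕ → Ultrafilter ℕ} {x : Ultrafilter ℕ}
    (hx : Tendsto f p (𝓝 x)) {s : Set ℕ} (hs : ∀ᶠ n in (p : Filter ℕ), s ∈ f n) : s ∈ x := by
  by_contra hc
  rw [← Ultrafilter.compl_mem_iff_notMem] at hc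
  obtain ⟨n, h1, h2⟩ := (hs.and (tendsto_nhds_iff.1 hx _ hc)).exists
  exact (Ultrafilter.compl_mem_iff_notMem.1 h2) h1

theorem IsSeparatedBy.tendsto {p : Ultrafilter ℕ} {f : ℕ → Ultrafilter ℕ} {x : Ultrafilter ℕ}
    {r : ℕ → ℕ} (hf : IsSeparatedBy f r) (hx : Tendsto f p (𝓝 x)) : Tendsto r x p := by
  intro T hT
  refine mem_of_eventually_mem hx (Filter.mem_of_superset hT fun n hn => ?_)
  filter_upwards [hf n] with k hk
  simpa [hk] using hn

/-- If `s < r` on `x`, then for almost all `n` the map `s` takes finitely many values below `n` on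
`f n`, hence is constant there, say `h n < n`. This regressive `h` would fix `p`. -/
theorem IsSeparatedBy.not_eventually_lt {p : Ultrafilter ℕ} {f : ℕ → Ultrafilter ℕ}
    {x : Ultrafilter ℕ} {r s : ℕ → ℕ} (hf : IsSeparatedBy f r) (hx : Tendsto f p (𝓝 x))
    (hs : Tendsto s x p) : ¬ ∀ᶠ k in (x : Filter ℕ), s k < r k := by
  intro hlt
  have h1 : ∀ᶠ n in (p : Filter ℕ), ∃ m, m < n ∧ ∀ᶠ k in (f n : Filter ℕ), s k = m := by
    filter_upwards [tendsto_nhds_iff.1 hx _ hlt] with n hn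
    have h2 : (⋃ m ∈ Set.Iio n, {k | s k = m}) ∈ f n := by
      filter_upwards [hn, hf n] with k hk hk'
      simp only [mem_iUnion]
      exact ⟨s k, by simpa [hk'] using hk, rfl⟩
    obtain ⟨m, hm, h3⟩ := (Ultrafilter.finite_biUnion_mem_iff (Set.finite_Iio n)).1 h2
    exact ⟨m, hm, h3⟩
  choose! h hh using fun n (hn : ∃ m, m < n ∧ ∀ᶠ k in (f n : Filter ℕ), s k = m) => hn
  refine not_eventually_lt_of_tendsto (p := p) (h := h) (fun T hT => ?_)
    (h1.mono fun n hn => (hh n hn).1)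
  have h2 : ∀ᶠ n in (p : Filter ℕ), s ⁻¹' T ∈ f n := tendsto_nhds_iff.1 hx _ (hs hT)
  rw [mem_map]
  filter_upwards [h1, h2] with n hn hn'
  obtain ⟨k, hk, hk'⟩ := (((hh n hn).2).and hn').exists
  simpa [← hk] using hk'

/-- Two separated sequences with the same limit along `p` agree on a member of `p`. -/
theorem IsSeparatedBy.eventuallyEq {p : Ultrafilter ℕ} {f g : ℕ → Ultrafilter ℕ}
    {x : Ultrafilter ℕ} {r s : ℕ → ℕ} (hf : IsSeparatedBy f r) (hg : IsSeparatedBy g s)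
    (hfx : Tendsto f p (𝓝 x)) (hgx : Tendsto g p (𝓝 x)) :
    ∀ᶠ n in (p : Filter ℕ), f n = g n := by
  have hrs : ∀ᶠ k in (x : Filter ℕ), r k = s k := by
    have h1 := Ultrafilter.eventually_not.2 (hf.not_eventually_lt hfx (hg.tendsto hgx))
    have h2 := Ultrafilter.eventually_not.2 (hg.not_eventually_lt hgx (hf.tendsto hfx))
    filter_upwards [h1, h2] with k h3 h4
    omega
  by_contra hne
  rw [← Ultrafilter.eventually_not] at hne
  have hZ : ∀ n, ∃ Z : Set ℕ, f n ≠ g n → Z ∈ f n ∧ Z ∉ g n := by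
    intro n
    by_cases h : f n = g n
    · exact ⟨∅, fun h' => absurd h h'⟩
    · by_contra! hc
      exact h (Ultrafilter.coe_injective
        ((g n).unique (fun Z hZ => by_contra fun hZ' => by
          have h3 : Zᶜ ∈ f n := Ultrafilter.compl_mem_iff_notMem.2 hZ'
          exact Ultrafilter.compl_mem_iff_notMem.1 ((hc Zᶜ).2 h3) hZ)))
  choose Z hZ using hZ
  -- The sets `Z n` are glued along the fibres of `r`; since `r = s` on `x`, the glued set also
  -- traces `Z n` on `g n`.
  have h1 : {k | k ∈ Z (r k)} ∈ x := by
    refine mem_of_eventually_mem hfx ?_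
    filter_upwards [hne] with n hn
    filter_upwards [hf n, (hZ n hn).1] with k hk hk'
    simpa [hk] using hk'
  obtain ⟨n, h2, h3, h4⟩ := ((tendsto_nhds_iff.1 hgx _ h1).and
    ((tendsto_nhds_iff.1 hgx _ hrs).and hne)).exists
  refine (hZ n h4).2 ?_
  filter_upwards [h2, h3, hg n] with k hk hk' hk''
  have h5 : r k = n := Eq.trans hk' hk''
  simpa [h5] using hk

/-! ### Two-colouring by parity of depth -/

section Coloring

variable {X : Type*} (S : Set X) (f : X → ℕ → X) (W : X → ℕ → Set X)

open Classical in
/-- Walk from `y` towards `z`: pass to the child `f y n` of `y` with `z ∈ W y n`, if there is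
one. -/
noncomputable def walk (z y : X) : X :=
  if h : y ∈ S ∧ ∃ n, z ∈ W y n then f y h.2.choose else y

/-- The walk towards `z` starting at `x` reaches `z` after exactly `k` steps. -/
def HasDepth (x z : X) (k : ℕ) : Prop :=
  (walk S f W z)^[k] x = z ∧ ∀ j < k, (walk S f W z)^[j] x ≠ z

variable {S f W}

theorem HasDepth.unique {x z : X} {k l : ℕ} (hk : HasDepth S f W x z k)
    (hl : HasDepth S f W x z l) : k = l := by
  rcases lt_trichotomy k l with h | h | h
  · exact absurd hk.1 (hl.2 k h)
  · exact h
  · exact absurd hl.1 (hk.2 l h)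

theorem walk_eq (hW : ∀ y ∈ S, Pairwise (Function.onFun Disjoint (W y))) {y z : X} {n : ℕ}
    (hy : y ∈ S) (hz : z ∈ W y n) : walk S f W z y = f y n := by
  have h : y ∈ S ∧ ∃ n, z ∈ W y n := ⟨hy, n, hz⟩
  rw [walk, dif_pos h]
  congr 1
  by_contra hne
  exact Set.disjoint_left.1 (hW y hy hne) h.2.choose_spec hz

/-- Each of the `k` steps towards `y` is decided by an open condition `y ∈ W a m`, which almost all
children of `y` inherit. -/
theorem HasDepth.eventually_child [TopologicalSpace X] {p : Ultrafilter ℕ}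
    (hWd : ∀ y ∈ S, Pairwise (Function.onFun Disjoint (W y)))
    (hWo : ∀ y ∈ S, ∀ n, IsOpen (W y n))
    (hfW : ∀ y ∈ S, ∀ n, f y n ∈ W y n) (hyW : ∀ y ∈ S, ∀ n, y ∉ W y n)
    (hlim : ∀ y ∈ S, Tendsto (f y) p (𝓝 y)) {x y : X} {k : ℕ} (hy : y ∈ S)
    (hk : HasDepth S f W x y k) :
    ∀ᶠ n in (p : Filter ℕ), HasDepth S f W x (f y n) (k + 1) := by
  have hself : ∀ z, walk S f W z z = z := by
    intro z
    rw [walk, dif_neg]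
    rintro ⟨h1, n, h2⟩
    exact hyW z h1 n h2
  have hiter : ∀ z w, walk S f W z w = w → ∀ i, (walk S f W z)^[i] w = w := fun z w h i =>
    Function.iterate_fixed h i
  have key : ∀ j ≤ k, ∀ᶠ n in (p : Filter ℕ),
      (walk S f W (f y n))^[j] x = (walk S f W y)^[j] x := by
    intro j
    induction j with
    | zero => intro _; exact Eventually.of_forall fun n => rfl
    | succ j ih =>
      intro hj
      set a := (walk S f W y)^[j] x with ha
      have hmove : a ∈ S ∧ ∃ m, y ∈ W a m := by
        by_contra hc
        have h1 : walk S f W y a = a := by rw [walk, dif_neg hc]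
        -- A walk stuck at `a` would stay there, so `a = y` is reached too early.
        have h2 := hiter y a h1 (k - j)
        rw [ha, ← Function.iterate_add_apply, Nat.sub_add_cancel (by omega), hk.1] at h2
        exact hk.2 j (by omega) h2.symm
      obtain ⟨haS, m, hm⟩ := hmove
      filter_upwards [ih (by omega), (hlim y hy).eventually ((hWo a haS m).mem_nhds hm)]
        with n h1 h2
      rw [Function.iterate_succ_apply', Function.iterate_succ_apply', h1, ← ha,
        walk_eq hWd haS hm, walk_eq hWd haS h2]
  have hall : ∀ᶠ n in (p : Filter ℕ), ∀ j ∈ Set.Iic k,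
      (walk S f W (f y n))^[j] x = (walk S f W y)^[j] x :=
    (eventually_all_finite (Set.finite_Iic k)).2 fun j hj => key j hj
  filter_upwards [hall] with n hn
  have hkn : (walk S f W (f y n))^[k] x = y := by rw [hn k (mem_Iic.2 le_rfl), hk.1]
  refine ⟨?_, fun j hj hc => ?_⟩
  · rw [Function.iterate_succ_apply', hkn, walk_eq hWd hy (hfW y hy n)]
  · have h2 := hiter (f y n) (f y n) (hself _) (k - j)
    nth_rewrite 2 [← hc] at h2
    rw [← Function.iterate_add_apply, Nat.sub_add_cancel (by omega), hkn] at h2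
    exact hyW y hy n (mem_of_eq_of_mem h2 (hfW y hy n))

/-- A partial two-colouring (with colour classes `P.1`, `P.2`) that gives every coloured `y ∈ S`
a colour different from that of `f y n` for `p`-almost all `n`. -/
def IsGood (S : Set X) (f : X → ℕ → X) (p : Ultrafilter ℕ) (P : Set X × Set X) : Prop :=
  Disjoint P.1 P.2 ∧ (∀ y ∈ S, y ∈ P.1 → ∀ᶠ n in (p : Filter ℕ), f y n ∈ P.2) ∧
    ∀ y ∈ S, y ∈ P.2 → ∀ᶠ n in (p : Filter ℕ), f y n ∈ P.1

theorem IsGood.swap {p : Ultrafilter ℕ} {P : Set X × Set X} (h : IsGood S f p P) :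
    IsGood S f p P.swap :=
  ⟨h.1.symm, h.2.2, h.2.1⟩

theorem exists_maximal_isGood (S : Set X) (f : X → ℕ → X) (p : Ultrafilter ℕ) :
    ∃ P, Maximal (IsGood S f p) P := by
  refine zorn_le₀ {P | IsGood S f p P} fun c hc hchain => ?_
  refine ⟨(⋃ P ∈ c, P.1, ⋃ P ∈ c, P.2), ⟨?_, ?_, ?_⟩, fun P hP =>
    ⟨subset_biUnion_of_mem (u := fun P : Set X × Set X => P.1) hP,
      subset_biUnion_of_mem (u := fun P : Set X × Set X => P.2) hP⟩⟩
  · simp only [disjoint_iUnion_left, disjoint_iUnion_right]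
    intro P hP Q hQ
    rcases hchain.total hP hQ with h | h
    · exact (hc hQ).1.mono_right h.2
    · exact (hc hP).1.mono_left h.1
  · intro y hy hyc
    obtain ⟨P, hP, hyP⟩ := mem_iUnion₂.1 hyc
    filter_upwards [(hc hP).2.1 y hy hyP] with n hn
    exact mem_iUnion₂.2 ⟨P, hP, hn⟩
  · intro y hy hyc
    obtain ⟨P, hP, hyP⟩ := mem_iUnion₂.1 hyc
    filter_upwards [(hc hP).2.2 y hy hyP] with n hn
    exact mem_iUnion₂.2 ⟨P, hP, hn⟩

theorem IsGood.insert {p : Ultrafilter ℕ} {P : Set X × Set X} (h : IsGood S f p P) {y : X}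
    (hy : y ∉ P.2) (hf : ∀ᶠ n in (p : Filter ℕ), f y n ∈ P.2) :
    IsGood S f p (insert y P.1, P.2) := by
  refine ⟨Set.disjoint_insert_left.2 ⟨hy, h.1⟩, ?_, fun z hz hzP => ?_⟩
  · rintro z hz (rfl | hzP)
    · exact hf
    · exact h.2.1 z hz hzP
  · exact (h.2.2 z hz hzP).mono fun n hn => Or.inr hn

/-- Otherwise almost all children share one colour, and `y` could take the other. -/
theorem Maximal.eventually_notMem {p : Ultrafilter ℕ} {P : Set X × Set X}
    (h : Maximal (IsGood S f p) P) {y : X} (hy1 : y ∉ P.1) (hy2 : y ∉ P.2) :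
    ∀ᶠ n in (p : Filter ℕ), f y n ∉ P.1 ∧ f y n ∉ P.2 := by
  refine Eventually.and (Ultrafilter.eventually_not.2 fun hc => ?_)
    (Ultrafilter.eventually_not.2 fun hc => ?_)
  · have h1 := (h.prop.swap.insert (y := y) hy1 hc).swap
    exact hy2 ((h.le_of_ge h1 ⟨le_rfl, Set.subset_insert _ _⟩).2 (Set.mem_insert _ _))
  · have h1 := h.prop.insert (y := y) hy2 hc
    exact hy1 ((h.le_of_ge h1 ⟨Set.subset_insert _ _, le_rfl⟩).1 (Set.mem_insert _ _))

theorem exists_coloring [TopologicalSpace X] {p : Ultrafilter ℕ}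
    (hWd : ∀ y ∈ S, Pairwise (Function.onFun Disjoint (W y)))
    (hWo : ∀ y ∈ S, ∀ n, IsOpen (W y n))
    (hfW : ∀ y ∈ S, ∀ n, f y n ∈ W y n) (hyW : ∀ y ∈ S, ∀ n, y ∉ W y n)
    (hlim : ∀ y ∈ S, Tendsto (f y) p (𝓝 y)) :
    ∃ A : Set X, ∀ y ∈ S, ∀ᶠ n in (p : Filter ℕ), ¬ (f y n ∈ A ↔ y ∈ A) := by
  obtain ⟨P, hP⟩ := exists_maximal_isGood S f p
  -- From an uncoloured `x`, parity of depth would extend the maximal colouring.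
  have hcover : ∀ x, x ∈ P.1 ∨ x ∈ P.2 := by
    by_contra! hx
    obtain ⟨x, hx1, hx2⟩ := hx
    let E : Set X := {z | (z ∉ P.1 ∧ z ∉ P.2) ∧ ∃ k, HasDepth S f W x z k ∧ Even k}
    let O : Set X := {z | (z ∉ P.1 ∧ z ∉ P.2) ∧ ∃ k, HasDepth S f W x z k ∧ ¬ Even k}
    have hgood : IsGood S f p (P.1 ∪ E, P.2 ∪ O) := by
      refine ⟨?_, ?_, ?_⟩
      · rw [Set.disjoint_left]
        rintro z (h1 | ⟨h1, k, hk, hk'⟩) (h2 | ⟨h2, l, hl, hl'⟩)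
        · exact Set.disjoint_left.1 hP.prop.1 h1 h2
        · exact h2.1 h1
        · exact h1.2 h2
        · exact hl' (hk.unique hl ▸ hk')
      · rintro y hy (h1 | ⟨h1, k, hk, hk'⟩)
        · exact (hP.prop.2.1 y hy h1).mono fun n hn => Or.inl hn
        · filter_upwards [Maximal.eventually_notMem hP h1.1 h1.2,
            hk.eventually_child hWd hWo hfW hyW hlim hy] with n h2 h3
          exact Or.inr ⟨h2, k + 1, h3, by simpa [Nat.even_add_one] using hk'⟩
      · rintro y hy (h1 | ⟨h1, k, hk, hk'⟩)
        · exact (hP.prop.2.2 y hy h1).mono fun n hn => Or.inl hn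
        · filter_upwards [Maximal.eventually_notMem hP h1.1 h1.2,
            hk.eventually_child hWd hWo hfW hyW hlim hy] with n h2 h3
          exact Or.inr ⟨h2, k + 1, h3, by simpa [Nat.even_add_one] using hk'⟩
    have hxE : x ∈ E := ⟨⟨hx1, hx2⟩, 0, ⟨rfl, fun j hj => absurd hj (Nat.not_lt_zero j)⟩, by simp⟩
    exact hx1 ((hP.le_of_ge hgood ⟨Set.subset_union_left, Set.subset_union_left⟩).1 (Or.inr hxE))
  refine ⟨P.1, fun y hy => ?_⟩
  rcases hcover y with h | h
  · filter_upwards [hP.prop.2.1 y hy h] with n hn hc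
    exact Set.disjoint_left.1 hP.prop.1 (hc.2 h) hn
  · filter_upwards [hP.prop.2.2 y hy h] with n hn hc
    exact Set.disjoint_left.1 hP.prop.1 (hc.1 hn) h

end Coloring

/-! ### Application to ultrafilters and to `ω*` -/

/-- For a nonprincipal ultrafilter `p` there is a two-colouring of the ultrafilters on `ℕ` for which
the limit along `p` of a separated sequence differs in colour from `p`-almost all of its terms. -/
theorem exists_set_forall_isSeparatedBy {p : Ultrafilter ℕ} (hp : (p : Filter ℕ) ≤ cofinite) :
    ∃ A : Set (Ultrafilter ℕ), ∀ f r y, IsSeparatedBy f r → Tendsto f p (𝓝 y) →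
      ∀ᶠ n in (p : Filter ℕ), ¬ (f n ∈ A ↔ y ∈ A) := by
  let S : Set (Ultrafilter ℕ) := {y | ∃ f r, IsSeparatedBy f r ∧ Tendsto f p (𝓝 y)}
  choose! F R hF hlim using fun y (hy : y ∈ S) => hy
  let W : Ultrafilter ℕ → ℕ → Set (Ultrafilter ℕ) := fun y n => {u | {k | R y k = n} ∈ u}
  have hWd : ∀ y ∈ S, Pairwise (Function.onFun Disjoint (W y)) := by
    intro y _ m n hmn
    refine Set.disjoint_left.2 fun u hu hu' => ?_
    obtain ⟨k, hk, hk'⟩ := (Filter.Eventually.and hu hu').exists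
    exact hmn (Eq.trans (Eq.symm hk) hk')
  have hfW : ∀ y ∈ S, ∀ n, F y n ∈ W y n := fun y hy n => hF y hy n
  have hWo : ∀ y ∈ S, ∀ n, IsOpen (W y n) := fun y _ n => ultrafilter_isOpen_basic _
  have hyW : ∀ y ∈ S, ∀ n, y ∉ W y n := by
    intro y hy n hc
    obtain ⟨m, h1, h2⟩ := (((hlim y hy).eventually ((hWo y hy n).mem_nhds hc)).and
      (hp (Set.finite_singleton n).compl_mem_cofinite)).exists
    exact Set.disjoint_left.1 (hWd y hy h2) (hfW y hy m) h1
  obtain ⟨A, hA⟩ := exists_coloring hWd hWo hfW hyW hlim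
  refine ⟨A, fun f r y hf hy => ?_⟩
  have hyS : y ∈ S := ⟨f, r, hf, hy⟩
  filter_upwards [hA y hyS, hf.eventuallyEq (hF y hyS) hy (hlim y hyS)] with n h1 h2
  rwa [h2]

theorem exists_isSeparatedBy {Y : Type*} [TopologicalSpace Y] {e : Y → Ultrafilter ℕ}
    (he : IsInducing e) {d : ℕ → Y} {U : ℕ → Set Y} (hU : ∀ n, IsOpen (U n))
    (hUd : Pairwise (Function.onFun Disjoint U)) (hd : ∀ n, d n ∈ U n) :
    ∃ r, IsSeparatedBy (e ∘ d) r := by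
  have h1 : ∀ n, ∃ B : Set ℕ, B ∈ e (d n) ∧ ∀ y, B ∈ e y → y ∈ U n := by
    intro n
    obtain ⟨O, hO, hOU⟩ := he.isOpen_iff.1 (hU n)
    have hdO : e (d n) ∈ O := by
      have := hd n
      rwa [← hOU] at this
    obtain ⟨_, ⟨B, rfl⟩, h2, h3⟩ := ultrafilterBasis_is_basis.exists_subset_of_mem_open hdO hO
    refine ⟨B, h2, fun y hy => ?_⟩
    rw [← hOU]
    exact h3 hy
  choose B hB hBU using h1
  have hnot : ∀ m n, m ≠ n → B m ∉ e (d n) := fun m n hmn hc =>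
    Set.disjoint_left.1 (hUd hmn) (hBU m _ hc) (hd n)
  classical
  -- Taking the least index makes the `B m` disjoint; the default `0` is never used on `B n`.
  refine ⟨fun k => if h : ∃ m, k ∈ B m then Nat.find h else 0, fun n => ?_⟩
  have h2 : ∀ᶠ k in (e (d n) : Filter ℕ), ∀ m ∈ Set.Iio n, k ∉ B m :=
    (eventually_all_finite (Set.finite_Iio n)).2 fun m hm =>
      Ultrafilter.eventually_not.2 (hnot m n (ne_of_lt hm))
  filter_upwards [h2, hB n] with k hk hk'
  have h3 : ∃ m, k ∈ B m := ⟨n, hk'⟩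
  rw [dif_pos h3, Nat.find_eq_iff]
  exact ⟨hk', fun m hm => hk m hm⟩

theorem exists_isEmbedding_stoneCech (α : Type*) [TopologicalSpace α] [DiscreteTopology α] :
    ∃ φ : StoneCech α → Ultrafilter α, IsEmbedding φ := by
  have hg : Continuous (pure : α → Ultrafilter α) := continuous_of_discreteTopology
  refine ⟨stoneCechExtend hg,
    ((continuous_stoneCechExtend hg).isClosedEmbedding ?_).isEmbedding⟩
  have h : Ultrafilter.extend (stoneCechUnit : α → StoneCech α) ∘ stoneCechExtend hg = id := by
    refine stoneCech_hom_ext ((continuous_ultrafilter_extend _).comp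
      (continuous_stoneCechExtend hg)) continuous_id ?_
    ext a
    simp [stoneCechExtend_stoneCechUnit]
  exact Function.LeftInverse.injective (congrFun h)

end OmegaStarPartition

open OmegaStarPartition in
theorem theorem5p14 (Y : Type*) [TopologicalSpace Y] [Infinite Y] [CountablyCompactSpace Y] :
    ¬ TopArrow OmegaStar Y := by
  intro harrow
  obtain ⟨φ, hφ⟩ := exists_isEmbedding_stoneCech ℕ
  have hι : IsEmbedding fun x : OmegaStar => φ x.1 := hφ.comp IsEmbedding.subtypeVal
  have hemb : ∀ P : Set OmegaStar, TopIncluded Y P →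
      ∃ e : Y → OmegaStar, IsEmbedding e ∧ ∀ y, e y ∈ P := by
    rintro P ⟨Y', hY', ⟨h⟩⟩
    exact ⟨fun y => (h y).1, IsEmbedding.subtypeVal.comp h.isEmbedding, fun y => hY' (h y).2⟩
  -- The trivial partition gives one embedding, needed only for the Hausdorff property.
  obtain ⟨e₀, he₀, -⟩ := hemb univ ((harrow univ univ (union_self _)).elim id id)
  have : T2Space Y := (hι.comp he₀).t2Space
  obtain ⟨U, hUi, hUo, hUd⟩ := exists_seq_infinite_isOpen_pairwise_disjoint Y
  choose d hd using fun n => (hUi n).nonempty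
  obtain ⟨y₀, -, hy₀⟩ := (CountablyCompactSpace.isCountablyCompact_univ (E := Y)).seq_clusterPt d
    (Eventually.of_forall fun _ => mem_univ _)
  obtain ⟨p, hp, hlim⟩ := mapClusterPt_iff_ultrafilter.1 hy₀
  obtain ⟨A, hA⟩ := exists_set_forall_isSeparatedBy (p := p) (hp.trans Nat.cofinite_eq_atTop.ge)
  have key : ∀ e : Y → OmegaStar, IsEmbedding e →
      ∃ n, ¬ (φ (e (d n)).1 ∈ A ↔ φ (e y₀).1 ∈ A) := by
    intro e he
    have hE := hι.comp he
    obtain ⟨r, hr⟩ := exists_isSeparatedBy hE.isInducing hUo hUd hd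
    exact (hA _ r _ hr ((hE.continuous.tendsto y₀).comp hlim)).exists
  rcases harrow {x | φ x.1 ∈ A} {x | φ x.1 ∉ A} (Set.union_compl_self _) with h | h
  · obtain ⟨e, he, heP⟩ := hemb _ h
    obtain ⟨n, hn⟩ := key e he
    exact hn (iff_of_true (heP (d n)) (heP y₀))
  · obtain ⟨e, he, heP⟩ := hemb _ h
    obtain ⟨n, hn⟩ := key e he
    exact hn (iff_of_false (heP (d n)) (heP y₀))
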